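/- **Theorem 1.1.** Let $V$ be a finite set, let $\Sigma$ be the set of all maps $V \to V$ (a semigroup under composition), let $\mu$ be a probability law on $\Sigma$, and put $\mathrm{Supp}(\mu) = \{\sigma \in \Sigma : \mu(\{\sigma\}) > 0\}$. The directed graph $(V,A)$ induced by $\mu$ has adjacency matrix $$A(y,x) = \#\{\sigma \in \mathrm{Supp}(\mu) : \sigma(x) = y\}, \qquad y,x \in V,$$ where $A(y,x)$ is the number of roads from $x$ to $y$; thus $\mathrm{Supp}(\mu)$ is a road coloring of $(V,A)$. Assume that $(V,A)$ satisfies: (A) $(V,A)$ is of constant outdegree ($\sum_{y} A(y,x)$ does not depend on $x$), strongly connected (for all $y,x \in V$ there is $n \ge 1$ with $A^n(y,x) \ge 1$) and aperiodic (for every $x \in V$ the greatest common divisor of $\{n \ge 1 : A^n(x,x) \ge 1\}$ is $1$). Let $\{X,N\}$ be a $\mu$-random walk, that is, $X = (X_k)_{k \in \mathbb{Z}}$ and $N = (N_k)_{k \in \mathbb{Z}}$ are processes on a probability space, with values in $V$ and $\Sigma$ respectively, such that $N_k$ is independent of $\sigma(X_j, N_j : j \le k-1)$ for each $k \in \mathbb{Z}$,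 the $N_k$ are independent and identically distributed with common law $\mu$, and $X_k = N_k(X_{k-1})$ a.s. for each $k \in \mathbb{Z}$. Then the following three assertions are equivalent: (i) $\mathrm{Supp}(\mu)$ is synchronizing: there exist $p \ge 1$ and $\sigma_1, \dots, \sigma_p \in \mathrm{Supp}(\mu)$ such that the composition $\sigma_p \cdots \sigma_1$ maps $V$ onto a singleton. (ii) For every $k \in \mathbb{Z}$, the limit $\lim_{l \to -\infty} N_k N_{k-1} \cdots N_{l+1}$ exists a.s. in the finite discrete space $\Sigma$. (iii) $\{X,N\}$ is strong: for every $k \in \mathbb{Z}$, $X_k$ is a.s. equal to a random variable that is measurable with respect to $\sigma(N_j : j \le k)$. -/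

import Mathlib

open MeasureTheory ProbabilityTheory Filter Topology

namespace RoadColoring

/-- The adjacency matrix `[σ(y,x)]` of a map `σ : V → V`, with `σ(y,x) = 1` if `y = σ x` and `0`
otherwise. Throughout, the entry `A y x` counts the roads from `x` to `y`. -/
def mapMatrix {V : Type*} [DecidableEq V] (σ : V → V) : Matrix V V ℕ :=
  Matrix.of fun y x => if y = σ x then 1 else 0

/-- The outdegree of the site `x`. -/
def outdeg {V : Type*} [Fintype V] (A : Matrix V V ℕ) (x : V) : ℕ := ∑ y, A y x

def IsConstantOutdegree {V : Type*} [Fintype V] (A : Matrix V V ℕ) : Prop :=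
  ∃ d : ℕ, ∀ x, outdeg A x = d

def IsStronglyConnected {V : Type*} [Fintype V] [DecidableEq V] (A : Matrix V V ℕ) : Prop :=
  ∀ y x, ∃ n : ℕ, 1 ≤ n ∧ 1 ≤ (A ^ n) y x

/-- The period at `x`: the greatest common divisor of the lengths of the closed walks at `x`. -/
noncomputable def period {V : Type*} [Fintype V] [DecidableEq V] (A : Matrix V V ℕ) (x : V) : ℕ :=
  Nat.setGcd {n : ℕ | 1 ≤ n ∧ 1 ≤ (A ^ n) x x}

def IsAperiodic {V : Type*} [Fintype V] [DecidableEq V] (A : Matrix V V ℕ) : Prop :=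
  ∀ x, period A x = 1

/-- Assumption (A). -/
structure AssumptionA {V : Type*} [Fintype V] [DecidableEq V] (A : Matrix V V ℕ) : Prop where
  constantOutdegree : IsConstantOutdegree A
  stronglyConnected : IsStronglyConnected A
  aperiodic : IsAperiodic A

/-- A finite family of maps (repetitions allowed) is a road coloring of the graph `(V, A)` if its
matrices add up to `A`. -/
def IsRoadColoring {V : Type*} [DecidableEq V] (C : Multiset (V → V)) (A : Matrix V V ℕ) : Prop :=
  A = (C.map mapMatrix).sum

/-- The composition `σ_p ∘ ⋯ ∘ σ_1` of the sequence `[σ_p, …, σ_1]`. -/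
def compose {V : Type*} (s : List (V → V)) : V → V := s.foldr (· ∘ ·) id

/-- A family `C` is synchronizing if some composition of members of `C` maps `V` onto a
singleton. -/
def IsSynchronizing {V : Type*} (C : Multiset (V → V)) : Prop :=
  ∃ s : List (V → V), s ≠ [] ∧ (∀ σ ∈ s, σ ∈ C) ∧ ∃ y, Set.range (compose s) = {y}

open Classical in
/-- The support of a law on the (finite) set of maps `V → V`. -/
noncomputable def supp {V : Type*} [Fintype V] [MeasurableSpace V] (μ : Measure (V → V)) :
    Finset (V → V) :=
  Finset.univ.filter fun σ => 0 < μ {σ}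

/-- The adjacency matrix of the directed graph induced by `μ`. -/
noncomputable def inducedGraph {V : Type*} [Fintype V] [DecidableEq V] [MeasurableSpace V]
    (μ : Measure (V → V)) : Matrix V V ℕ :=
  ∑ σ ∈ supp μ, mapMatrix σ

theorem isRoadColoring_supp {V : Type*} [Fintype V] [DecidableEq V] [MeasurableSpace V]
    (μ : Measure (V → V)) : IsRoadColoring (supp μ).val (inducedGraph μ) := rfl

/-- The pair of processes `{X, N}` on the probability space `(Ω, P)` is a `μ`-random walk. -/
structure IsRandomWalk {V Ω : Type*} [MeasurableSpace V] [MeasurableSpace Ω]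
    (μ : Measure (V → V)) (P : Measure Ω) (X : ℤ → Ω → V) (N : ℤ → Ω → (V → V)) : Prop where
  measurable_X : ∀ k, Measurable (X k)
  measurable_N : ∀ k, Measurable (N k)
  /-- `N_k` is independent of `σ(X_j, N_j : j ≤ k - 1)`. -/
  indep_past : ∀ k, Indep (MeasurableSpace.comap (N k) inferInstance)
    (⨆ j ≤ k - 1, MeasurableSpace.comap (X j) inferInstance ⊔
      MeasurableSpace.comap (N j) inferInstance) P
  iIndepFun_N : iIndepFun N P
  law_N : ∀ k, P.map (N k) = μ
  evolution : ∀ k, ∀ᵐ ω ∂P, X k ω = N k ω (X (k - 1) ω)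

/-- `X_k` is a.s. equal to a variable measurable with respect to `σ(N_j : j ≤ k)`, for all `k`. -/
def IsStrong {V Ω : Type*} [MeasurableSpace V] [MeasurableSpace Ω]
    (P : Measure Ω) (X : ℤ → Ω → V) (N : ℤ → Ω → (V → V)) : Prop :=
  ∀ k, ∃ Y : Ω → V,
    Measurable[⨆ j ≤ k, MeasurableSpace.comap (N j) inferInstance] Y ∧ X k =ᵐ[P] Y

/-- The product `n_k n_{k-1} ⋯ n_{l+1}` for `l ≤ k` (the identity when `l ≥ k`). -/
def backwardProd {V : Type*} (n : ℤ → (V → V)) (k l : ℤ) : V → V :=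
  compose ((List.range (k - l).toNat).map fun i => n (k - i))

end RoadColoring

/-! By independence, every word over the support almost surely occurs in the past noise
(`ae_exists_infix`). If a synchronizing word occurs, the backward product is constant from then on,
and its value is the position; this gives (ii) and (iii).

Conversely, if the backward products stabilize at `φ`, each road `σ` recurs beyond the stabilization
time, so `φ ∘ σ = φ`. Strong connectivity then makes `φ` constant (`eq_of_forall_comp_eq`), and `φ`
is itself a product of roads.

For (iii) to (i), primitivity bounds the mass of every site below by some `ε > 0`. Without
synchronization, each word moves some site off `x`, and the walk occupies that site, independently
of the word, with probability at least `ε`. So no finite-noise event nearly forces `X k = x`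
(`mul_measure_recentWord_mem_le`), whereas under (iii) such events approximate `{X 0 = x}`. -/

namespace RoadColoring

/-! ### Primitivity and invariant maps of the graph -/

section Graph

variable {V : Type*} [Fintype V] [DecidableEq V]

theorem one_le_pow_add_iff (A : Matrix V V ℕ) (m n : ℕ) (y x : V) :
    1 ≤ (A ^ (m + n)) y x ↔ ∃ z, 1 ≤ (A ^ m) y z ∧ 1 ≤ (A ^ n) z x := by
  rw [pow_add, Matrix.mul_apply, Nat.one_le_iff_ne_zero, Ne, Finset.sum_eq_zero_iff]
  simp [Nat.one_le_iff_ne_zero]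

/-- A strongly connected aperiodic graph is primitive. -/
theorem exists_forall_one_le_pow {A : Matrix V V ℕ} (hc : IsStronglyConnected A)
    (ha : IsAperiodic A) : ∃ n : ℕ, ∀ y x, 1 ≤ (A ^ n) y x := by
  have loops (x : V) : ∃ n : ℕ, ∀ m ≥ n, 1 ≤ (A ^ m) x x := by
    obtain ⟨n, hn⟩ := Nat.exists_mem_closure_of_ge {n : ℕ | 1 ≤ n ∧ 1 ≤ (A ^ n) x x}
    -- Closed-walk lengths at `x` are closed under addition; since their gcd is 1, they include all
    -- large integers.
    let S : AddSubmonoid ℕ :=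
      { carrier := {n | 1 ≤ (A ^ n) x x}
        zero_mem' := by simp
        add_mem' := fun {a b} h₁ h₂ => (one_le_pow_add_iff A a b x x).2 ⟨x, h₁, h₂⟩ }
    refine ⟨n, fun m hm => ?_⟩
    have hle : AddSubmonoid.closure {n : ℕ | 1 ≤ n ∧ 1 ≤ (A ^ n) x x} ≤ S :=
      AddSubmonoid.closure_le.2 fun n hn => hn.2
    refine hle (hn m hm ?_)
    have := ha x
    rw [period] at this
    rw [this]
    exact one_dvd m
  choose f hf using loops
  choose g hg using hc
  -- One length for all pairs: beyond the `g y x` steps from `x` to `y`, at least `f x` steps remain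
  -- for a closed walk at `x`.
  refine ⟨∑ x, f x + ∑ y, ∑ x, g y x, fun y x => ?_⟩
  have h₁ : f x ≤ ∑ x, f x := Finset.single_le_sum (fun _ _ => Nat.zero_le _) (Finset.mem_univ x)
  have h₂ : g y x ≤ ∑ x, g y x :=
    Finset.single_le_sum (f := g y) (fun _ _ => Nat.zero_le _) (Finset.mem_univ x)
  have h₃ : ∑ x, g y x ≤ ∑ y, ∑ x, g y x :=
    Finset.single_le_sum (f := fun y => ∑ x, g y x) (fun _ _ => Nat.zero_le _) (Finset.mem_univ y)
  obtain ⟨m, hm⟩ := Nat.exists_eq_add_of_le (show g y x ≤ ∑ x, f x + ∑ y, ∑ x, g y x by omega)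
  rw [hm, one_le_pow_add_iff]
  exact ⟨x, (hg y x).2, hf x m (by omega)⟩

variable [MeasurableSpace V]

omit [DecidableEq V] in
theorem mem_supp {μ : Measure (V → V)} {σ : V → V} : σ ∈ supp μ ↔ 0 < μ {σ} := by
  simp [supp]

theorem one_le_inducedGraph_iff {μ : Measure (V → V)} {y x : V} :
    1 ≤ inducedGraph μ y x ↔ ∃ σ ∈ supp μ, σ x = y := by
  rw [inducedGraph, Matrix.sum_apply, Nat.one_le_iff_ne_zero, Ne, Finset.sum_eq_zero_iff]
  simp [mapMatrix, eq_comm]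

/-- A map invariant under all roads of a strongly connected graph is constant. -/
theorem eq_of_forall_comp_eq {μ : Measure (V → V)} (hc : IsStronglyConnected (inducedGraph μ))
    {φ : V → V} (hφ : ∀ σ ∈ supp μ, φ ∘ σ = φ) (y x : V) : φ y = φ x := by
  obtain ⟨n, -, hn⟩ := hc y x
  induction n generalizing y with
  | zero =>
    by_cases h : y = x
    · rw [h]
    · simp [h] at hn
  | succ n ih =>
    rw [add_comm, one_le_pow_add_iff] at hn
    obtain ⟨z, hz, hn⟩ := hn
    rw [pow_one, one_le_inducedGraph_iff] at hz
    obtain ⟨σ, hσ, rfl⟩ := hz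
    exact (congrFun (hφ σ hσ) z).trans (ih z hn)

end Graph

/-! ### Words and backward products -/

section Words

variable {V : Type*}

theorem compose_nil : compose ([] : List (V → V)) = id := rfl

theorem compose_cons (σ : V → V) (s : List (V → V)) : compose (σ :: s) = σ ∘ compose s := rfl

theorem compose_append (s t : List (V → V)) : compose (s ++ t) = compose s ∘ compose t := by
  induction s with
  | nil => rfl
  | cons σ s ih => rw [List.cons_append, compose_cons, compose_cons, ih]; rfl

/-- The word `[n_k, n_{k-1}, …, n_{k-m+1}]`. -/
def recentWord (n : ℤ → (V → V)) (k : ℤ) (m : ℕ) : List (V → V) :=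
  (List.range m).map fun i : ℕ => n (k - i)

theorem backwardProd_sub (n : ℤ → (V → V)) (k : ℤ) (m : ℕ) :
    backwardProd n k (k - m) = compose (recentWord n k m) := by
  simp [backwardProd, recentWord, ← List.map_eq_flatMap, Function.comp_def]

theorem length_recentWord (n : ℤ → (V → V)) (k : ℤ) (m : ℕ) : (recentWord n k m).length = m := by
  simp [recentWord]

theorem recentWord_zero (n : ℤ → (V → V)) (k : ℤ) : recentWord n k 0 = [] := rfl

theorem recentWord_add (n : ℤ → (V → V)) (k : ℤ) (m p : ℕ) :
    recentWord n k (m + p) = recentWord n k m ++ recentWord n (k - m) p := by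
  simp [recentWord, List.range_add, sub_sub, Function.comp_def]

theorem recentWord_one (n : ℤ → (V → V)) (k : ℤ) : recentWord n k 1 = [n k] := by
  simp [recentWord]

theorem recentWord_succ (n : ℤ → (V → V)) (k : ℤ) (m : ℕ) :
    recentWord n k (m + 1) = n k :: recentWord n (k - 1) m := by
  rw [add_comm, recentWord_add, recentWord_one]; simp

theorem compose_recentWord_add (n : ℤ → (V → V)) (k : ℤ) (m p : ℕ) :
    compose (recentWord n k (m + p)) =
      compose (recentWord n k m) ∘ compose (recentWord n (k - m) p) := by
  rw [recentWord_add, compose_append]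

theorem recentWord_eq_take (n : ℤ → (V → V)) (k : ℤ) {m p : ℕ} (h : m ≤ p) :
    recentWord n k m = (recentWord n k p).take m := by
  obtain ⟨q, rfl⟩ := Nat.exists_eq_add_of_le h
  rw [recentWord_add, List.take_append_of_le_length (length_recentWord n k m).ge,
    List.take_of_length_le (length_recentWord n k m).le]

theorem tendsto_backwardProd_iff [TopologicalSpace V] [DiscreteTopology V] [Finite V]
    {n : ℤ → (V → V)} {k : ℤ} {σ : V → V} :
    Tendsto (fun l : ℤ => backwardProd n k l) atBot (𝓝 σ) ↔
      ∀ᶠ m : ℕ in atTop, compose (recentWord n k m) = σ := by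
  rw [nhds_discrete, tendsto_pure]
  simp_rw [← backwardProd_sub]
  constructor
  · intro h
    have : Tendsto (fun m : ℕ => k - (m : ℤ)) atTop atBot := by
      refine tendsto_atBot.2 fun b => ?_
      filter_upwards [eventually_ge_atTop (k - b).toNat] with m hm
      omega
    exact this.eventually h
  · intro h
    obtain ⟨M, hM⟩ := eventually_atTop.1 h
    filter_upwards [eventually_le_atBot (k - M)] with l hl
    have := hM (k - l).toNat (by omega)
    rwa [show k - ((k - l).toNat : ℤ) = l by omega] at this

end Words

/-! ### Independence of recent words from the earlier past -/

section RandomWalk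

variable {V Ω : Type*} [MeasurableSpace V] [MeasurableSpace Ω]

/-- The σ-algebra `σ(X_j, N_j : j ≤ k)`. -/
abbrev past (X : ℤ → Ω → V) (N : ℤ → Ω → (V → V)) (k : ℤ) : MeasurableSpace Ω :=
  ⨆ j ≤ k, MeasurableSpace.comap (X j) inferInstance ⊔ MeasurableSpace.comap (N j) inferInstance

/-- The σ-algebra `σ(N_j : j ≤ k)`. -/
abbrev pastNoise (N : ℤ → Ω → (V → V)) (k : ℤ) : MeasurableSpace Ω :=
  ⨆ j ≤ k, MeasurableSpace.comap (N j) inferInstance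

variable {X : ℤ → Ω → V} {N : ℤ → Ω → (V → V)}

omit [MeasurableSpace Ω] in
theorem past_mono {j k : ℤ} (h : j ≤ k) : past X N j ≤ past X N k :=
  biSup_mono fun _ hi => hi.trans h

omit [MeasurableSpace Ω] in
theorem pastNoise_le_past (k : ℤ) : pastNoise N k ≤ past X N k :=
  iSup₂_mono fun _ _ => le_sup_right

omit [MeasurableSpace Ω] in
theorem measurable_noise_pastNoise {j k : ℤ} (h : j ≤ k) : Measurable[pastNoise N k] (N j) :=
  Measurable.of_comap_le (le_iSup₂ (f := fun j (_ : j ≤ k) => MeasurableSpace.comap (N j) _) j h)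

omit [MeasurableSpace Ω] in
theorem measurable_walk_past (k : ℤ) : Measurable[past X N k] (X k) :=
  Measurable.of_comap_le (le_sup_left.trans
    (le_iSup₂ (f := fun j (_ : j ≤ k) => MeasurableSpace.comap (X j) _ ⊔
      MeasurableSpace.comap (N j) inferInstance) k le_rfl))

variable {μ : Measure (V → V)} {P : Measure Ω}

theorem IsRandomWalk.past_le (h : IsRandomWalk μ P X N) (k : ℤ) : past X N k ≤ ‹_› :=
  iSup₂_le fun j _ => sup_le (h.measurable_X j).comap_le (h.measurable_N j).comap_le

theorem IsRandomWalk.pastNoise_le (h : IsRandomWalk μ P X N) (k : ℤ) : pastNoise N k ≤ ‹_› :=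
  (pastNoise_le_past k).trans (h.past_le k)

variable [Fintype V] [DiscreteMeasurableSpace V]

omit [MeasurableSpace Ω] in
theorem measurableSet_recentWord_eq (k : ℤ) (m : ℕ) (s : List (V → V)) :
    MeasurableSet[pastNoise N k] {ω | recentWord (N · ω) k m = s} := by
  induction m generalizing k s with
  | zero => simp [recentWord_zero]
  | succ m ih =>
    cases s with
    | nil => simp [recentWord_succ]
    | cons σ t =>
      simp only [recentWord_succ, List.cons.injEq]
      have hm : pastNoise N (k - 1) ≤ pastNoise N k := biSup_mono fun i hi => hi.trans (by omega)
      exact MeasurableSet.inter (measurable_noise_pastNoise le_rfl (measurableSet_singleton σ))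
        (hm _ (ih (k - 1) t))

omit [MeasurableSpace Ω] in
theorem measurableSet_recentWord_mem (k : ℤ) (m : ℕ) (T : Set (List (V → V))) :
    MeasurableSet[pastNoise N k] {ω | recentWord (N · ω) k m ∈ T} := by
  have : {ω | recentWord (N · ω) k m ∈ T} = ⋃ s ∈ T, {ω | recentWord (N · ω) k m = s} := by
    ext; simp
  rw [this]
  exact MeasurableSet.biUnion T.to_countable fun s _ => measurableSet_recentWord_eq k m s

variable (h : IsRandomWalk μ P X N)
include h

theorem IsRandomWalk.measure_noise_eq_inter (k : ℤ) (σ : V → V) {a : Set Ω}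
    (ha : MeasurableSet[past X N (k - 1)] a) : P ({ω | N k ω = σ} ∩ a) = μ {σ} * P a := by
  rw [← h.law_N k, Measure.map_apply (h.measurable_N k) (measurableSet_singleton σ)]
  exact (Indep_iff _ _ _).1 (h.indep_past k) _ _ ⟨{σ}, measurableSet_singleton σ, rfl⟩ ha

/-- A word of noises is independent of the preceding past, and its law is a product. -/
theorem IsRandomWalk.measure_recentWord_eq_inter (k : ℤ) (s : List (V → V)) {a : Set Ω}
    (ha : MeasurableSet[past X N (k - s.length)] a) :
    P ({ω | recentWord (N · ω) k s.length = s} ∩ a) = (s.map fun σ => μ {σ}).prod * P a := by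
  induction s generalizing k with
  | nil => simp [recentWord_zero]
  | cons σ t ih =>
    have ha' : MeasurableSet[past X N (k - 1 - t.length)] a := by
      convert ha using 2
      rw [List.length_cons]; push_cast; ring
    have : {ω | recentWord (N · ω) k (σ :: t).length = σ :: t} ∩ a =
        {ω | N k ω = σ} ∩ ({ω | recentWord (N · ω) (k - 1) t.length = t} ∩ a) := by
      ext; simp [recentWord_succ, and_assoc]
    rw [this, h.measure_noise_eq_inter, ih _ ha', List.map_cons, List.prod_cons, mul_assoc]
    exact MeasurableSet.inter (pastNoise_le_past _ _ (measurableSet_recentWord_eq _ _ _))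
      (past_mono (by omega) _ ha')

variable [IsProbabilityMeasure P]

theorem IsRandomWalk.measure_recentWord_eq (k : ℤ) (s : List (V → V)) :
    P {ω | recentWord (N · ω) k s.length = s} = (s.map fun σ => μ {σ}).prod := by
  simpa using h.measure_recentWord_eq_inter k s (a := Set.univ) MeasurableSet.univ

theorem IsRandomWalk.measure_recentWord_eq_inter' (k : ℤ) (m : ℕ) (s : List (V → V)) {a : Set Ω}
    (ha : MeasurableSet[past X N (k - m)] a) :
    P ({ω | recentWord (N · ω) k m = s} ∩ a) = P {ω | recentWord (N · ω) k m = s} * P a := by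
  by_cases hs : s.length = m
  · subst hs
    rw [h.measure_recentWord_eq_inter k s ha, h.measure_recentWord_eq]
  · have : {ω | recentWord (N · ω) k m = s} = ∅ := by
      ext ω
      simp only [Set.mem_ofPred_eq, Set.mem_empty_iff_false, iff_false]
      rintro rfl
      exact hs (length_recentWord _ k m)
    simp [this]

omit [IsProbabilityMeasure P] in
-- Countable additivity for `P.restrict a`, as there are countably many words; `a` need not be
-- measurable.
theorem IsRandomWalk.measure_recentWord_mem_inter_eq_tsum (k : ℤ) (m : ℕ) (T : Set (List (V → V)))
    (a : Set Ω) :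
    P ({ω | recentWord (N · ω) k m ∈ T} ∩ a) =
      ∑' s : T, P ({ω | recentWord (N · ω) k m = s} ∩ a) := by
  have hm (s) : MeasurableSet {ω | recentWord (N · ω) k m = s} :=
    h.pastNoise_le k _ (measurableSet_recentWord_eq k m s)
  have := tsum_measure_preimage_singleton (μ := P.restrict a) T.to_countable
    (f := fun ω => recentWord (N · ω) k m) fun s _ => hm s
  have hT : MeasurableSet {ω | recentWord (N · ω) k m ∈ T} :=
    h.pastNoise_le k _ (measurableSet_recentWord_mem k m T)
  rw [← Measure.restrict_apply hT]
  refine this.symm.trans (tsum_congr fun s => ?_)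
  exact Measure.restrict_apply (hm s)

theorem IsRandomWalk.measure_recentWord_mem_inter (k : ℤ) (m : ℕ) (T : Set (List (V → V)))
    {a : Set Ω} (ha : MeasurableSet[past X N (k - m)] a) :
    P ({ω | recentWord (N · ω) k m ∈ T} ∩ a) = P {ω | recentWord (N · ω) k m ∈ T} * P a := by
  have := h.measure_recentWord_mem_inter_eq_tsum k m T Set.univ
  simp only [Set.inter_univ] at this
  rw [h.measure_recentWord_mem_inter_eq_tsum, this, ← ENNReal.tsum_mul_right]
  exact tsum_congr fun s => h.measure_recentWord_eq_inter' k m s ha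

omit [IsProbabilityMeasure P] in
theorem IsRandomWalk.ae_noise_mem_supp : ∀ᵐ ω ∂P, ∀ k, N k ω ∈ supp μ := by
  classical
  refine ae_all_iff.2 fun k => ?_
  rw [← ae_map_iff (p := (· ∈ supp μ)) (h.measurable_N k).aemeasurable
    (DiscreteMeasurableSpace.forall_measurableSet _), h.law_N k, ae_iff_of_countable]
  intro σ hσ
  exact mem_supp.2 (pos_iff_ne_zero.2 hσ)

omit [IsProbabilityMeasure P] [Fintype V] [DiscreteMeasurableSpace V] in
theorem IsRandomWalk.ae_walk_eq :
    ∀ᵐ ω ∂P, ∀ (m : ℕ) (k : ℤ), X k ω = compose (recentWord (N · ω) k m) (X (k - m) ω) := by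
  filter_upwards [ae_all_iff.2 h.evolution] with ω hω m
  induction m with
  | zero => simp [recentWord_zero, compose_nil]
  | succ m ih =>
    intro k
    rw [recentWord_succ, compose_cons, Function.comp_apply, hω k, ih (k - 1)]
    congr 3
    push_cast; ring

end RandomWalk

/-! ### Recurrence of words, synchronization and limits -/

section Equivalence

open scoped ENNReal symmDiff

variable {V Ω : Type*} [Fintype V] [MeasurableSpace V] [DiscreteMeasurableSpace V]
  [MeasurableSpace Ω] {X : ℤ → Ω → V} {N : ℤ → Ω → (V → V)} {μ : Measure (V → V)} {P : Measure Ω}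
  [IsProbabilityMeasure P]

/-- Every word over the support almost surely occurs in the past. -/
theorem IsRandomWalk.ae_exists_infix (h : IsRandomWalk μ P X N) {s : List (V → V)}
    (hs : ∀ σ ∈ s, σ ∈ supp μ) (k : ℤ) : ∀ᵐ ω ∂P, ∃ m, s <:+: recentWord (N · ω) k m := by
  let c : ℝ≥0∞ := (s.map fun σ => μ {σ}).prod
  have hc : 0 < c := by
    refine pos_iff_ne_zero.2 (List.prod_ne_zero ?_)
    simp only [List.mem_map, not_exists, not_and]
    exact fun σ hσ => (mem_supp.1 (hs σ hσ)).ne'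
  let B : ℕ → Set Ω := fun m => {ω | recentWord (N · ω) k m ∈ {u | ¬ s <:+: u}}
  -- If `s` is absent from the longer word, it is absent from the first `m` letters and differs from
  -- the next block, and these events are independent.
  have step (m : ℕ) : P (B (m + s.length)) ≤ P (B m) * (1 - c) := by
    have hm : MeasurableSet[past X N (k - m)]
        {ω | recentWord (N · ω) (k - m) s.length = s} :=
      pastNoise_le_past _ _ (measurableSet_recentWord_eq _ _ _)
    have h₁ : P {ω | recentWord (N · ω) (k - m) s.length = s}ᶜ = 1 - c := by
      rw [prob_compl_eq_one_sub (h.past_le _ _ hm), h.measure_recentWord_eq]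
    rw [← h₁, ← h.measure_recentWord_mem_inter k m _ hm.compl]
    refine measure_mono fun ω hω => ⟨fun hi => hω ?_, fun he => hω ?_⟩
    · rw [recentWord_add]
      exact hi.trans (List.prefix_append _ _).isInfix
    · rw [recentWord_add]
      have he : recentWord (N · ω) (k - m) s.length = s := he
      rw [he]
      exact (List.suffix_append _ _).isInfix
  have geom (n : ℕ) : P (B (n * s.length)) ≤ (1 - c) ^ n := by
    induction n with
    | zero => simpa using prob_le_one
    | succ n ih =>
      rw [Nat.succ_mul, pow_succ]
      exact (step _).trans (mul_le_mul_left ih _)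
  have hlt : 1 - c < 1 := ENNReal.sub_lt_self ENNReal.one_ne_top one_ne_zero hc.ne'
  rw [ae_iff]
  refine le_antisymm ?_ zero_le
  refine ge_of_tendsto' (ENNReal.tendsto_pow_atTop_nhds_zero_of_lt_one hlt) fun n => ?_
  refine (measure_mono fun ω hω => ?_).trans (geom n)
  exact fun hi => hω ⟨_, hi⟩

/-- If the support is synchronizing, the backward products are almost surely eventually
constant. -/
theorem IsRandomWalk.ae_exists_compose_eq_const (h : IsRandomWalk μ P X N)
    (hs : IsSynchronizing (supp μ).val) (k : ℤ) :
    ∀ᵐ ω ∂P, ∃ m y, compose (recentWord (N · ω) k m) = fun _ => y := by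
  obtain ⟨s, -, hs, y, hy⟩ := hs
  have hconst : compose s = fun _ => y :=
    funext fun v => Set.mem_singleton_iff.1 (hy ▸ Set.mem_range_self v)
  filter_upwards [h.ae_exists_infix (fun σ hσ => hs σ hσ) k] with ω ⟨m, a, b, hm⟩
  refine ⟨m, compose a y, ?_⟩
  rw [← hm, compose_append, compose_append, hconst]
  rfl

theorem IsRandomWalk.ae_tendsto_of_isSynchronizing [TopologicalSpace V] [DiscreteTopology V]
    (h : IsRandomWalk μ P X N) (hs : IsSynchronizing (supp μ).val) (k : ℤ) :
    ∀ᵐ ω ∂P, ∃ σ : V → V,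
      Tendsto (fun l : ℤ => backwardProd (fun j => N j ω) k l) atBot (𝓝 σ) := by
  filter_upwards [h.ae_exists_compose_eq_const hs k] with ω ⟨m, y, hm⟩
  refine ⟨fun _ => y, tendsto_backwardProd_iff.2 ?_⟩
  filter_upwards [eventually_ge_atTop m] with n hn
  obtain ⟨p, rfl⟩ := Nat.exists_eq_add_of_le hn
  rw [compose_recentWord_add, hm]
  rfl

theorem IsRandomWalk.isStrong_of_isSynchronizing (h : IsRandomWalk μ P X N)
    (hs : IsSynchronizing (supp μ).val) : IsStrong P X N := by
  classical
  intro k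
  obtain ⟨ω₀⟩ := nonempty_of_isProbabilityMeasure P
  let v₀ := X 0 ω₀
  let E : Set Ω := {ω | ∃ m y, compose (recentWord (N · ω) k m) = fun _ => y}
  have hword (m : ℕ) (T : Set (List (V → V))) :
      MeasurableSet[pastNoise N k] {ω | recentWord (N · ω) k m ∈ T} :=
    measurableSet_recentWord_mem k m T
  have hconst (m : ℕ) : MeasurableSet[pastNoise N k]
      {ω | ∃ y, compose (recentWord (N · ω) k m) = fun _ => y} :=
    hword m {u | ∃ y, compose u = fun _ => y}
  have hE : MeasurableSet[pastNoise N k] E := by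
    have : E = ⋃ m, {ω | ∃ y, compose (recentWord (N · ω) k m) = fun _ => y} := by
      ext; simp [E]
    rw [this]
    exact MeasurableSet.iUnion hconst
  let f : ℕ → Ω → V := fun m ω => compose (recentWord (N · ω) k m) v₀
  have hf (m : ℕ) : Measurable[pastNoise N k] (f m) :=
    @measurable_to_countable' _ _ _ _ (pastNoise N k) _ fun y => hword m {u | compose u v₀ = y}
  -- The alternative `ω ∉ E` keeps the search for the first constant product total; it only matters
  -- on a null set.
  let p : ℕ → Ω → Prop := fun m ω => (∃ y, compose (recentWord (N · ω) k m) = fun _ => y) ∨ ω ∉ E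
  have hp (m : ℕ) : MeasurableSet[pastNoise N k] {ω | p m ω} := (hconst m).union hE.compl
  have hex (ω : Ω) : ∃ m, p m ω := by
    by_cases hω : ω ∈ E
    · obtain ⟨m, hm⟩ := hω
      exact ⟨m, Or.inl hm⟩
    · exact ⟨0, Or.inr hω⟩
  refine ⟨fun ω => f (Nat.find (hex ω)) ω, Measurable.find hf hp hex, ?_⟩
  filter_upwards [h.ae_exists_compose_eq_const hs k, h.ae_walk_eq] with ω hω hX
  obtain ⟨y, hy⟩ := (Nat.find_spec (hex ω)).resolve_right (not_not.2 hω)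
  rw [hX (Nat.find (hex ω)) k]
  simp only [f, hy]

theorem IsRandomWalk.isSynchronizing_of_ae_tendsto [DecidableEq V] [TopologicalSpace V]
    [DiscreteTopology V]
    (h : IsRandomWalk μ P X N) (hc : IsStronglyConnected (inducedGraph μ))
    (hlim : ∀ᵐ ω ∂P, ∃ σ : V → V,
      Tendsto (fun l : ℤ => backwardProd (fun j => N j ω) 0 l) atBot (𝓝 σ)) :
    IsSynchronizing (supp μ).val := by
  have hinf : ∀ᵐ ω ∂P, ∀ (σ : supp μ) (k : ℤ), ∃ m, [σ.1] <:+: recentWord (N · ω) k m :=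
    ae_all_iff.2 fun σ => ae_all_iff.2 fun k => h.ae_exists_infix (by simp) k
  -- A single typical sample path suffices.
  obtain ⟨ω, ⟨φ, hφ⟩, hinf, hsupp⟩ := (hlim.and (hinf.and h.ae_noise_mem_supp)).exists
  obtain ⟨M, hM⟩ := eventually_atTop.1 (tendsto_backwardProd_iff.1 hφ)
  have hinv (σ : V → V) (hσ : σ ∈ supp μ) : φ ∘ σ = φ := by
    -- Searching back from time `-M` finds `σ` where the product equals `φ` both before and after
    -- `σ` is appended.
    obtain ⟨m, hm⟩ := hinf ⟨σ, hσ⟩ (-M)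
    have hmem : σ ∈ recentWord (N · ω) (-M) m := hm.subset (by simp)
    obtain ⟨i, -, rfl⟩ := List.mem_map.1 hmem
    have h₁ := hM (M + i + 1) (by omega)
    rw [compose_recentWord_add, hM (M + i) (by omega), recentWord_one, compose_cons,
      compose_nil, Function.comp_id] at h₁
    convert h₁ using 3
    push_cast; ring
  -- Length `M + 1` keeps the word nonempty; `X 0 ω` is just some site.
  refine ⟨recentWord (N · ω) 0 (M + 1), ?_, ?_, φ (X 0 ω), ?_⟩
  · simp [recentWord_succ]
  · intro σ hσ
    obtain ⟨i, -, rfl⟩ := List.mem_map.1 hσ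
    exact hsupp _
  · rw [hM (M + 1) (by omega)]
    ext y
    simp only [Set.mem_range, Set.mem_singleton_iff]
    constructor
    · rintro ⟨v, rfl⟩
      exact eq_of_forall_comp_eq hc hinv _ _
    · rintro rfl
      exact ⟨_, rfl⟩

/-! ### From strongness to synchronization -/

omit [IsProbabilityMeasure P] in
-- Each edge of a walk from `x` to `y` is followed with probability at least `c`, independently of
-- the past.
theorem IsRandomWalk.pow_mul_measure_walk_le [DecidableEq V] (h : IsRandomWalk μ P X N)
    {c : ℝ≥0∞} (hc : ∀ σ ∈ supp μ, c ≤ μ {σ}) {n : ℕ} {y x : V}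
    (hn : 1 ≤ (inducedGraph μ ^ n) y x) (k : ℤ) :
    c ^ n * P {ω | X (k - n) ω = x} ≤ P {ω | X k ω = y} := by
  induction n generalizing y k with
  | zero =>
    by_cases hxy : y = x
    · simp [hxy]
    · simp [hxy] at hn
  | succ n ih =>
    rw [add_comm, one_le_pow_add_iff] at hn
    obtain ⟨z, hz, hn⟩ := hn
    rw [pow_one, one_le_inducedGraph_iff] at hz
    obtain ⟨σ, hσ, rfl⟩ := hz
    have hX : MeasurableSet[past X N (k - 1)] {ω | X (k - 1) ω = z} :=
      measurable_walk_past (k - 1) (measurableSet_singleton z)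
    calc c ^ (n + 1) * P {ω | X (k - (n + 1 : ℕ)) ω = x}
        = c * (c ^ n * P {ω | X (k - 1 - n) ω = x}) := by
          rw [pow_succ', mul_assoc, show k - ((n + 1 : ℕ) : ℤ) = k - 1 - n by push_cast; ring]
      _ ≤ μ {σ} * P {ω | X (k - 1) ω = z} := mul_le_mul' (hc σ hσ) (ih hn (k - 1))
      _ = P ({ω | N k ω = σ} ∩ {ω | X (k - 1) ω = z}) := (h.measure_noise_eq_inter k σ hX).symm
      _ ≤ P {ω | X k ω = σ z} := by
          refine measure_mono_ae ?_
          filter_upwards [h.evolution k] with ω hω hω'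
          obtain ⟨h₁, h₂⟩ : N k ω = σ ∧ X (k - 1) ω = z := hω'
          change X k ω = σ z
          rw [hω, h₁, h₂]

/-- The laws of the positions give uniformly positive mass to all sites. -/
theorem IsRandomWalk.exists_pos_le_measure_walk [DecidableEq V] (h : IsRandomWalk μ P X N)
    (hA : AssumptionA (inducedGraph μ)) :
    ∃ ε : ℝ≥0∞, 0 < ε ∧ ∀ k x, ε ≤ P {ω | X k ω = x} := by
  obtain ⟨n, hn⟩ := exists_forall_one_le_pow hA.stronglyConnected hA.aperiodic
  obtain ⟨c, hc, hcμ⟩ : ∃ c : ℝ≥0∞, 0 < c ∧ ∀ σ ∈ supp μ, c ≤ μ {σ} :=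
    ⟨(supp μ).inf fun σ => μ {σ}, (Finset.lt_inf_iff ENNReal.zero_lt_top).2 fun σ hσ =>
      mem_supp.1 hσ, fun σ hσ => Finset.inf_le hσ⟩
  -- Sum the previous bound over all starting sites.
  refine ⟨c ^ n / Fintype.card V, ENNReal.div_pos (pow_ne_zero _ hc.ne')
    (ENNReal.natCast_ne_top _), fun k y => ENNReal.div_le_of_le_mul' ?_⟩
  have hsum : ∑ x, P {ω | X (k - n) ω = x} = 1 := by
    have := sum_measure_preimage_singleton (μ := P) Finset.univ (f := X (k - n))
      fun y _ => h.measurable_X _ (measurableSet_singleton y)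
    rw [Finset.coe_univ, Set.preimage_univ, measure_univ] at this
    exact this
  calc c ^ n = ∑ x, c ^ n * P {ω | X (k - n) ω = x} := by
        rw [← Finset.mul_sum, hsum, mul_one]
    _ ≤ ∑ _x : V, P {ω | X k ω = y} := Finset.sum_le_sum fun x _ =>
        h.pow_mul_measure_walk_le hcμ (hn y x) k
    _ = Fintype.card V * P {ω | X k ω = y} := by
        rw [Finset.sum_const, Finset.card_univ, nsmul_eq_mul]

/-- Without synchronization, no finite observation of the noise determines the position. -/
theorem IsRandomWalk.mul_measure_recentWord_mem_le (h : IsRandomWalk μ P X N)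
    (hs : ¬ IsSynchronizing (supp μ).val) {ε : ℝ≥0∞} (hε : ∀ k x, ε ≤ P {ω | X k ω = x})
    (k : ℤ) (x : V) (m : ℕ) (T : Set (List (V → V))) :
    ε * P {ω | recentWord (N · ω) k (m + 1) ∈ T} ≤
      P ({ω | recentWord (N · ω) k (m + 1) ∈ T} ∩ {ω | X k ω ≠ x}) := by
  have := h.measure_recentWord_mem_inter_eq_tsum k (m + 1) T Set.univ
  simp only [Set.inter_univ] at this
  rw [this, h.measure_recentWord_mem_inter_eq_tsum, ← ENNReal.tsum_mul_left]
  refine ENNReal.tsum_le_tsum ?_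
  rintro ⟨s, -⟩
  by_cases h₀ : P {ω | recentWord (N · ω) k (m + 1) = s} = 0
  · simp [h₀]
  -- Positive probability makes `s` a word over the support, so it cannot be constantly `x`.
  obtain ⟨ω, hω, hsupp⟩ :=
    ((frequently_ae_iff.2 h₀).and_eventually h.ae_noise_mem_supp).exists
  obtain ⟨v, hv⟩ : ∃ v, compose s v ≠ x := by
    by_contra! hall
    refine hs ⟨s, ?_, fun σ hσ => ?_, x, ?_⟩
    · rintro rfl
      simp [recentWord_succ] at hω
    · rw [← hω] at hσ
      obtain ⟨i, -, rfl⟩ := List.mem_map.1 hσ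
      exact hsupp _
    · exact Set.eq_singleton_iff_unique_mem.2
        ⟨⟨X 0 ω, hall _⟩, by rintro _ ⟨v, rfl⟩; exact hall v⟩
  have hX : MeasurableSet[past X N (k - (m + 1 : ℕ))] {ω | X (k - (m + 1 : ℕ)) ω = v} :=
    measurable_walk_past _ (measurableSet_singleton v)
  calc ε * P {ω | recentWord (N · ω) k (m + 1) = s}
      ≤ P {ω | recentWord (N · ω) k (m + 1) = s} * P {ω | X (k - (m + 1 : ℕ)) ω = v} := by
        rw [mul_comm]
        gcongr
        exact hε _ _
    _ = P ({ω | recentWord (N · ω) k (m + 1) = s} ∩ {ω | X (k - (m + 1 : ℕ)) ω = v}) :=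
        (h.measure_recentWord_eq_inter' k (m + 1) s hX).symm
    _ ≤ _ := by
        refine measure_mono_ae ?_
        filter_upwards [h.ae_walk_eq] with ω hω hω'
        obtain ⟨h₁, h₂⟩ :
          recentWord (N · ω) k (m + 1) = s ∧ X (k - (m + 1 : ℕ)) ω = v := hω'
        refine ⟨h₁, ?_⟩
        change X k ω ≠ x
        rw [hω (m + 1) k, h₁, h₂]
        exact hv

/-- The events determined by finitely many, and at least one, of the noises up to time `k`. -/
def finiteNoiseEvents (N : ℤ → Ω → (V → V)) (k : ℤ) : Set (Set Ω) :=
  {B | ∃ (m : ℕ) (T : Set (List (V → V))), B = {ω | recentWord (N · ω) k (m + 1) ∈ T}}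

omit [Fintype V] [MeasurableSpace V] [DiscreteMeasurableSpace V] [MeasurableSpace Ω] in
theorem isSetRing_finiteNoiseEvents (k : ℤ) : IsSetRing (finiteNoiseEvents N k) where
  empty_mem := ⟨0, ∅, by simp⟩
  union_mem := by
    rintro _ _ ⟨m, S, rfl⟩ ⟨n, T, rfl⟩
    refine ⟨m + n, {u | u.take (m + 1) ∈ S ∨ u.take (n + 1) ∈ T}, ?_⟩
    ext ω
    rw [Set.mem_ofPred_eq, Set.mem_ofPred_eq, ← recentWord_eq_take _ _ (by omega),
      ← recentWord_eq_take _ _ (by omega)]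
    rfl
  sdiff_mem := by
    rintro _ _ ⟨m, S, rfl⟩ ⟨n, T, rfl⟩
    refine ⟨m + n, {u | u.take (m + 1) ∈ S ∧ u.take (n + 1) ∉ T}, ?_⟩
    ext ω
    rw [Set.mem_ofPred_eq, Set.mem_ofPred_eq, ← recentWord_eq_take _ _ (by omega),
      ← recentWord_eq_take _ _ (by omega)]
    rfl

omit [MeasurableSpace Ω] in
theorem pastNoise_eq_generateFrom (k : ℤ) :
    pastNoise N k = MeasurableSpace.generateFrom (finiteNoiseEvents N k) := by
  refine le_antisymm (iSup₂_le fun j hj => ?_) (MeasurableSpace.generateFrom_le ?_)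
  · rintro _ ⟨S, -, rfl⟩
    refine MeasurableSpace.measurableSet_generateFrom
      -- The oldest of the `k - j + 1` letters is the noise at time `j`.
      ⟨(k - j).toNat, {u | ∃ σ ∈ S, u.getLast? = some σ}, ?_⟩
    ext ω
    simp [recentWord_add, recentWord_one, hj]
  · rintro _ ⟨m, T, rfl⟩
    exact measurableSet_recentWord_mem k (m + 1) T

theorem IsRandomWalk.isSynchronizing_of_isStrong [DecidableEq V] (h : IsRandomWalk μ P X N)
    (hA : AssumptionA (inducedGraph μ)) (hst : IsStrong P X N) :
    IsSynchronizing (supp μ).val := by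
  by_contra hs
  obtain ⟨ε, hε, hle⟩ := h.exists_pos_le_measure_walk hA
  obtain ⟨Y, hY, hXY⟩ := hst 0
  obtain ⟨ω₀⟩ := nonempty_of_isProbabilityMeasure P
  let x := X 0 ω₀
  let E : Set Ω := {ω | Y ω = x}
  have hE : MeasurableSet[pastNoise N 0] E := hY (measurableSet_singleton x)
  have hXE : P {ω | X 0 ω = x} = P E := by
    refine measure_congr ?_
    filter_upwards [hXY] with ω hω
    exact congrArg (· = x) hω
  have hε₁ : ε ≤ 1 := (hle 0 x).trans prob_le_one
  have hpos : 0 < ε * ε := ENNReal.mul_pos hε.ne' hε.ne'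
  have hpN : pastNoise N 0 ≤ ‹MeasurableSpace Ω› := h.pastNoise_le 0
  -- With error `δ = P (t ∆ E)`, one has `ε ≤ P t + δ` and `ε * P t ≤ δ`, so `ε * ε ≤ 2δ`; hence
  -- this tolerance.
  obtain ⟨t, ht, htE⟩ : ∃ t ∈ finiteNoiseEvents N 0, P (t ∆ E) < ε * ε / 2 := by
    obtain ⟨t, ht, htE⟩ := @exists_measure_symmDiff_lt_of_generateFrom_isSetRing _
      (pastNoise N 0) (P.trim hpN) _ _ (isSetRing_finiteNoiseEvents 0)
      ⟨{Set.univ}, Set.countable_singleton _, by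
        rw [Set.singleton_subset_iff]; exact ⟨0, Set.univ, by simp⟩, by simp⟩
      (pastNoise_eq_generateFrom 0) E hE _ (ENNReal.half_pos hpos.ne')
    exact ⟨t, ht, (le_trim hpN).trans_lt htE⟩
  obtain ⟨m, T, rfl⟩ := ht
  have h₁ := h.mul_measure_recentWord_mem_le hs hle 0 x m T
  set t := {ω | recentWord (N · ω) 0 (m + 1) ∈ T}
  have h₂ : P (t ∩ {ω | X 0 ω ≠ x}) ≤ P (t ∆ E) := by
    refine measure_mono_ae ?_
    filter_upwards [hXY] with ω hω hω'
    exact Or.inl ⟨hω'.1, fun hYx => hω'.2 (hω.trans hYx)⟩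
  have h₃ : P E ≤ P t + P (t ∆ E) := by
    refine (measure_mono fun ω hω => ?_).trans (measure_union_le _ _)
    by_cases hωt : ω ∈ t
    · exact Or.inl hωt
    · exact Or.inr (Or.inr ⟨hω, hωt⟩)
  refine lt_irrefl (ε * ε) ?_
  calc ε * ε ≤ ε * (P t + P (t ∆ E)) := by
        gcongr
        exact (hle 0 x).trans (hXE.le.trans h₃)
    _ = ε * P t + ε * P (t ∆ E) := mul_add _ _ _
    _ ≤ P (t ∆ E) + P (t ∆ E) := add_le_add (h₁.trans h₂) (mul_le_of_le_one_left zero_le hε₁)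
    _ < ε * ε / 2 + ε * ε / 2 := ENNReal.add_lt_add htE htE
    _ = ε * ε := ENNReal.add_halves _

end Equivalence
end RoadColoring

open RoadColoring in
theorem theorem1p1 {V : Type*} [Fintype V] [DecidableEq V]
    [MeasurableSpace V] [DiscreteMeasurableSpace V] [TopologicalSpace V] [DiscreteTopology V]
    {Ω : Type*} [MeasurableSpace Ω] (P : Measure Ω) [IsProbabilityMeasure P]
    (μ : Measure (V → V)) [IsProbabilityMeasure μ]
    (X : ℤ → Ω → V) (N : ℤ → Ω → (V → V)) (hXN : IsRandomWalk μ P X N)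
    (hA : AssumptionA (inducedGraph μ)) :
    List.TFAE [
      IsSynchronizing (supp μ).val,
      ∀ k : ℤ, ∀ᵐ ω ∂P, ∃ σ : V → V,
        Tendsto (fun l : ℤ => backwardProd (fun j => N j ω) k l) atBot (𝓝 σ),
      IsStrong P X N] := by
  tfae_have 1 → 2 := hXN.ae_tendsto_of_isSynchronizing
  tfae_have 2 → 1 := fun hlim => hXN.isSynchronizing_of_ae_tendsto hA.stronglyConnected (hlim 0)
  tfae_have 1 → 3 := hXN.isStrong_of_isSynchronizing
  tfae_have 3 → 1 := hXN.isSynchronizing_of_isStrong hA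
  tfae_finish
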